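/- Let $k$ be a field and let $X$, $Z$ be irreducible varieties over $k$ (integral separated schemes of finite type over $k$). Let $\pi\colon X\to Z$ be a branched cover, that is, a dominant $k$-morphism with $\dim X=\dim Z$ such that the extension $k(X)/k(Z)$ of function fields is separable (hence finite), and let $d=[k(X):k(Z)]$ be its degree. Let $U\subseteq Z$ be the largest open subset over which $\pi$ is finite étale (equivalently, étale with all fibers of degree $d$). For $1\le s\le d$ let $X_Z^s$ be the $s$-fold fiber product $X\times_Z\cdots\times_Z X$ with structure map $\pi^s\colon X_Z^s\to Z$, and let $X_Z^{(s)}\subseteq X_Z^s$ be the closure of the complement of the big diagonal (the closed locus of $s$-tuples with a repeated coordinate) in $(\pi^s)^{-1}(U)$. Let $X'$ be any irreducible component of $X_Z^{(d)}$, and let the monodromy group $\mathrm{Mon}_\pi$ be the subgroup of those permutations in the symmetric group $S_d$, acting on $X_Z^d$ by permuting the factors, that map $X'$ onto itself. Then, for every $1\le s\le d$, the group $\mathrm{Mon}_\pi\subseteq S_d$ is $s$-transitive (that is, it acts transitively on the $s$-tuples of distinct elements of $\{1,\dots,d\}$) if and only if the variety $X_Z^{(s)}$ is irreducible. -/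

import Mathlib

open CategoryTheory CategoryTheory.Limits AlgebraicGeometry

universe u

namespace BranchedCover

noncomputable section

/-- A dominant morphism of irreducible schemes sends the generic point to a point that
specializes to the generic point of the target (so to the generic point itself). -/
theorem map_genericPoint_specializes {X Z : Scheme.{u}} [IrreducibleSpace X] [IrreducibleSpace Z]
    (π : X ⟶ Z) [IsDominant π] : π (genericPoint X) ⤳ genericPoint Z := by
  have h : closure ({π (genericPoint X)} : Set Z) = Set.univ := by
    have h1 := (genericPoint_spec X).image π.continuous
    have h2 : closure (π '' (⊤ : Set X)) = Set.univ := by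
      simpa [Set.image_univ] using π.denseRange.closure_range
    exact h1.def.trans h2
  rw [specializes_iff_mem_closure, h]
  trivial

/-- The embedding `k(Z) → k(X)` of function fields induced by a dominant morphism. -/
def functionFieldMap {X Z : Scheme.{u}} [IrreducibleSpace X] [IrreducibleSpace Z]
    (π : X ⟶ Z) [IsDominant π] : Z.functionField ⟶ X.functionField :=
  Z.presheaf.stalkSpecializes (map_genericPoint_specializes π) ≫ π.stalkMap (genericPoint X)

/-- The degree `[k(X) : k(Z)]` of a dominant morphism of integral schemes. -/
def degree {X Z : Scheme.{u}} [IsIntegral X] [IsIntegral Z] (π : X ⟶ Z) [IsDominant π] : ℕ :=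
  letI : Algebra Z.functionField X.functionField := (functionFieldMap π).hom.toAlgebra
  Module.finrank Z.functionField X.functionField

/-- A morphism of integral schemes (in the theorem: of irreducible varieties over a field) is a
branched cover if it is dominant, source and target have the same dimension, and the extension
of function fields is separable. -/
class IsBranchedCover {X Z : Scheme.{u}} [IsIntegral X] [IsIntegral Z] (π : X ⟶ Z) : Prop
    extends IsDominant π where
  dim_eq : topologicalKrullDim X = topologicalKrullDim Z
  separable :
    letI : Algebra Z.functionField X.functionField := (functionFieldMap π).hom.toAlgebra
    Algebra.IsSeparable Z.functionField X.functionField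

/-- The largest open `U ⊆ Z` over which `π` is finite étale. For a branched cover of degree `d`
this is the largest open over which `π` is étale with all fibers of degree `d`; over the complex
numbers it is the largest Zariski open over which `π` is a covering space.
(Being finite étale is local on the target, so `π` is finite étale over this union.) -/
def etaleLocus {X Z : Scheme.{u}} (π : X ⟶ Z) : Z.Opens :=
  sSup {V : Z.Opens | IsFinite (π ∣_ V) ∧ Etale (π ∣_ V)}

/-- The `s`-fold fiber product `X ×_Z ⋯ ×_Z X`. -/
abbrev fiberPower {X Z : Scheme.{u}} (π : X ⟶ Z) (s : ℕ) : Scheme.{u} :=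
  widePullback Z (fun _ : Fin s => X) (fun _ => π)

/-- The `i`-th coordinate projection. -/
abbrev proj {X Z : Scheme.{u}} (π : X ⟶ Z) (s : ℕ) (i : Fin s) : fiberPower π s ⟶ X :=
  WidePullback.π (fun _ : Fin s => π) i

/-- The structure map of the fiber power to `Z`. -/
abbrev toBase {X Z : Scheme.{u}} (π : X ⟶ Z) (s : ℕ) : fiberPower π s ⟶ Z :=
  WidePullback.base (fun _ : Fin s => π)

/-- The big diagonal: the union over `i ≠ j` of the (scheme-theoretic) loci where the `i`-th
and `j`-th coordinates agree. -/
def bigDiagonal {X Z : Scheme.{u}} (π : X ⟶ Z) (s : ℕ) : Set (fiberPower π s) :=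
  ⋃ (i : Fin s) (j : Fin s) (_ : i ≠ j), Set.range (equalizer.ι (proj π s i) (proj π s j))

/-- The underlying closed set of the variety `X_Z^{(s)}`: the closure in the `s`-fold fiber
product of the complement of the big diagonal in the preimage of the étale locus. -/
def distinctLocus {X Z : Scheme.{u}} (π : X ⟶ Z) (s : ℕ) : Set (fiberPower π s) :=
  closure ((toBase π s ⁻¹' (etaleLocus π : Set Z)) \ bigDiagonal π s)

/-- The action of a permutation `σ` on the fiber power, on points
`(x₁, …, xₛ) ↦ (x_{σ⁻¹ 1}, …, x_{σ⁻¹ s})`. -/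
def permMap {X Z : Scheme.{u}} (π : X ⟶ Z) (s : ℕ) (σ : Equiv.Perm (Fin s)) :
    fiberPower π s ⟶ fiberPower π s :=
  WidePullback.lift (toBase π s) (fun i => proj π s (σ⁻¹ i))
    (fun i => WidePullback.π_arrow (fun _ : Fin s => π) (σ⁻¹ i))

@[simp]
theorem permMap_proj {X Z : Scheme.{u}} (π : X ⟶ Z) (s : ℕ) (σ : Equiv.Perm (Fin s))
    (i : Fin s) : permMap π s σ ≫ proj π s i = proj π s (σ⁻¹ i) :=
  WidePullback.lift_π _ _ _ _ _

@[simp]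
theorem permMap_toBase {X Z : Scheme.{u}} (π : X ⟶ Z) (s : ℕ) (σ : Equiv.Perm (Fin s)) :
    permMap π s σ ≫ toBase π s = toBase π s :=
  WidePullback.lift_base _ _ _ _

theorem permMap_one {X Z : Scheme.{u}} (π : X ⟶ Z) (s : ℕ) : permMap π s 1 = 𝟙 _ := by
  refine WidePullback.hom_ext _ _ _ (fun j => ?_) ?_
  · rw [permMap_proj]; simp
  · rw [permMap_toBase]; simp

theorem permMap_mul {X Z : Scheme.{u}} (π : X ⟶ Z) (s : ℕ) (σ τ : Equiv.Perm (Fin s)) :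
    permMap π s (σ * τ) = permMap π s τ ≫ permMap π s σ := by
  refine WidePullback.hom_ext _ _ _ (fun j => ?_) ?_
  · rw [Category.assoc, permMap_proj, permMap_proj, permMap_proj]; simp
  · rw [Category.assoc, permMap_toBase, permMap_toBase, permMap_toBase]

/-- `T` is an irreducible component of the subspace `S`: a maximal irreducible subset of it. -/
def IsComponentOf {Y : Type u} [TopologicalSpace Y] (T S : Set Y) : Prop :=
  Maximal (fun A : Set Y => IsIrreducible A ∧ A ⊆ S) T

/-- The subgroup of permutations of the coordinates that preserve the subset `T` of the fiber
power. When `s` is the degree of the branched cover `π` and `T` is an irreducible component of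
`X_Z^{(s)}`, this is the monodromy group of `π`. -/
def monodromyGroup {X Z : Scheme.{u}} (π : X ⟶ Z) (s : ℕ) (T : Set (fiberPower π s)) :
    Subgroup (Equiv.Perm (Fin s)) where
  carrier := {σ | permMap π s σ '' T = T}
  one_mem' := by simp [permMap_one]
  mul_mem' := by
    intro σ τ hσ hτ
    simp only [Set.mem_ofPred_eq] at hσ hτ ⊢
    rw [permMap_mul, Scheme.Hom.comp_base, TopCat.coe_comp, Set.image_comp, hτ, hσ]
  inv_mem' := by
    intro σ hσ
    simp only [Set.mem_ofPred_eq] at hσ ⊢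
    conv_lhs => rw [← hσ]
    rw [← Set.image_comp, ← TopCat.coe_comp, ← Scheme.Hom.comp_base, ← permMap_mul]
    simp [permMap_one]

end

end BranchedCover

/-!
Over the étale locus `U` the structure maps `X_Z^s → Z` are finite and flat. The fiber over the
generic point `η` of `Z` is therefore discrete, and by flatness every point over `U` is a
specialization of a point over `η`. The big diagonal being closed, `X_Z^{(s)}` is the closure of
the finite discrete set `P_s` of points over `η` with distinct coordinates
(`distinctLocus_eq_closure`). So `X_Z^{(s)}` is irreducible iff `P_s` has one point, and its
irreducible components are the closures of the points of `P_s`.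

Let `L = k(Z)`, `K = k(X)`, and let `Ω` be an algebraic closure of `L`. The generic point of `X` is
the only point of `X` over `η`, so a tuple of `L`-embeddings `K → Ω` is the same as an `Ω`-point of
`X_Z^s` over `η`. Every point over `η` underlies such an `Ω`-point (`exists_eq_tuplePoint`), two
`Ω`-points have the same underlying point iff they are conjugate under `Gal(Ω/L)`
(`tuplePoint_eq_iff`), and the point avoids the big diagonal iff the embeddings are distinct
(`tuplePoint_mem_bigDiagonal_iff`). Hence `X_Z^{(s)}` is irreducible iff `Gal(Ω/L)` acts
`s`-transitively on the `d`-element set of embeddings `K → Ω`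
(`isIrreducible_distinctLocus_iff`).

Finally, a component `X'` of `X_Z^{(d)}` is the closure of the point of a tuple `t` of `d` distinct
embeddings, which is a bijection of `{1, …, d}` with the set of all embeddings. A permutation
preserves `X'` iff it fixes that point, that is, iff it is induced along `t` by a Galois
automorphism. So the monodromy group is the image of `Gal(Ω/L)` in `S_d`, and the two transitivity
conditions agree (`isMultiplyPretransitive_iff_of_equiv`).
-/

namespace BranchedCover

/-! ### Closures of discrete and of finite sets -/

section Topology

variable {Y : Type u} [TopologicalSpace Y] {P T : Set Y}

theorem isIrreducible_closure_iff_of_isDiscrete (hP : _root_.IsDiscrete P) (hne : P.Nonempty) :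
    IsIrreducible (closure P) ↔ P.Subsingleton := by
  refine ⟨fun h ↦ hP.subsingleton_of_isPreirreducible (isIrreducible_iff_closure.mp h).2,
    fun h ↦ isIrreducible_iff_closure.mpr ?_⟩
  obtain ⟨p, hp⟩ := hne
  rw [h.eq_singleton_of_mem hp]
  exact isIrreducible_singleton

theorem IsComponentOf.exists_eq_closure_singleton (hfin : P.Finite)
    (hT : IsComponentOf T (closure P)) : ∃ p ∈ P, T = closure {p} := by
  have hcl : closure P = ⋃ p ∈ P, closure {p} := by
    rw [← hfin.closure_biUnion, Set.biUnion_of_singleton]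
  obtain ⟨⟨hirr, hsub⟩, hmax⟩ := hT
  obtain ⟨W, hW, hTW⟩ := isIrreducible_iff_sUnion_isClosed.mp hirr
    (hfin.image fun p ↦ closure {p}).toFinset
    (by simp) (by simpa [hcl] using hsub)
  simp only [Set.Finite.mem_toFinset, Set.mem_image] at hW
  obtain ⟨p, hp, rfl⟩ := hW
  exact ⟨p, hp, hTW.antisymm (hmax ⟨isIrreducible_singleton.closure,
    closure_mono (Set.singleton_subset_iff.mpr hp)⟩ hTW)⟩

end Topology

/-! ### Restriction of morphisms over an open subset of the target -/

section Restriction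

variable {X Y Z : Scheme.{u}}

/-- Quasi-finiteness over a neighborhood of `z` already makes the fiber over `z` discrete. -/
theorem isDiscrete_fiber_of_mem (f : X ⟶ Z) (V : Z.Opens) [LocallyQuasiFinite (f ∣_ V)] {z : Z}
    (hz : z ∈ V) : _root_.IsDiscrete (f ⁻¹' {z}) := by
  have h := ((f ∣_ V).isDiscrete_preimage_singleton ⟨z, hz⟩).image
    (f ⁻¹ᵁ V).ι.isOpenEmbedding.isInducing
  convert h using 1
  ext x
  simp only [Set.mem_preimage, Set.mem_singleton_iff, Set.mem_image]
  constructor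
  · intro hx
    exact ⟨⟨x, show f x ∈ V from hx ▸ hz⟩, Subtype.ext
      ((morphismRestrict_base_coe f V _).trans hx), rfl⟩
  · rintro ⟨y, hy, rfl⟩
    have := morphismRestrict_base_coe f V y
    rw [hy] at this
    exact this.symm

theorem exists_specializes_of_flat (f : X ⟶ Z) (V : Z.Opens) [Flat (f ∣_ V)] {x : X} {z : Z}
    (hx : f x ∈ V) (hz : z ⤳ f x) : ∃ y, f y = z ∧ y ⤳ x := by
  have hzV : z ∈ V := hz.mem_open V.2 hx
  let x' : (f ⁻¹ᵁ V).toScheme := ⟨x, hx⟩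
  have h : (⟨z, hzV⟩ : V.toScheme) ⤳ (f ∣_ V) x' :=
    V.ι.isOpenEmbedding.isInducing.specializes_iff.mp
      (by rw [show V.ι ((f ∣_ V) x') = f x from morphismRestrict_base_coe f V x']; exact hz)
  obtain ⟨y, hy, hy'⟩ := Flat.generalizingMap (f ∣_ V) h
  refine ⟨y.1, ?_, hy.map (f ⁻¹ᵁ V).ι.continuous⟩
  rw [← morphismRestrict_base_coe f V y, hy']

theorem morphismRestrict_of_isPullback (P : MorphismProperty Scheme.{u})
    [P.IsStableUnderBaseChange] {W : Scheme.{u}} {a : W ⟶ X} {b : W ⟶ Y}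
    {f : X ⟶ Z} {g : Y ⟶ Z} (h : IsPullback a b f g) (V : Z.Opens) (hg : P (g ∣_ V)) :
    P (a ∣_ (f ⁻¹ᵁ V)) := by
  have h1 := (isPullback_morphismRestrict a (f ⁻¹ᵁ V)).flip.paste_horiz h.flip
  rw [← morphismRestrict_ι] at h1
  have h2 := (isPullback_morphismRestrict g V).flip
  exact P.of_isPullback (.of_right' h1 h2) hg

end Restriction

/-! ### Fiber powers -/

section FiberPower

variable {X Z Y : Scheme.{u}} {π : X ⟶ Z} {s : ℕ}

/-- The morphism to the fiber power with prescribed coordinates. -/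
noncomputable def fiberLift (b : Y ⟶ Z) (f : Fin s → (Y ⟶ X)) (h : ∀ i, f i ≫ π = b) :
    Y ⟶ fiberPower π s :=
  WidePullback.lift b f h

@[simp]
theorem fiberLift_proj (b : Y ⟶ Z) (f : Fin s → (Y ⟶ X)) (h : ∀ i, f i ≫ π = b) (i : Fin s) :
    fiberLift b f h ≫ proj π s i = f i :=
  WidePullback.lift_π _ _ _ _ _

@[simp]
theorem fiberLift_toBase (b : Y ⟶ Z) (f : Fin s → (Y ⟶ X)) (h : ∀ i, f i ≫ π = b) :
    fiberLift b f h ≫ toBase π s = b :=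
  WidePullback.lift_base _ _ _ _

theorem proj_comp (i : Fin s) : proj π s i ≫ π = toBase π s :=
  WidePullback.π_arrow (fun _ : Fin s ↦ π) i

theorem fiberPower_hom_ext {f g : Y ⟶ fiberPower π s} (h : ∀ i, f ≫ proj π s i = g ≫ proj π s i)
    (hb : f ≫ toBase π s = g ≫ toBase π s) : f = g :=
  WidePullback.hom_ext _ _ _ h hb

/-- The fiber power `X_Z^{s+1}` is the fiber product of `X_Z^s` and `X`; the first coordinate is the
one split off. -/
theorem isPullback_fiberPower_succ (π : X ⟶ Z) (s : ℕ) :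
    IsPullback
      (fiberLift (toBase π (s + 1)) (fun i ↦ proj π (s + 1) i.succ) (fun i ↦ proj_comp i.succ) :
        fiberPower π (s + 1) ⟶ fiberPower π s)
      (proj π (s + 1) 0) (toBase π s) π := by
  refine ⟨⟨by rw [fiberLift_toBase, proj_comp]⟩, ⟨PullbackCone.IsLimit.mk _
    (fun c ↦ fiberLift (c.fst ≫ toBase π s)
      (Fin.cases c.snd fun i ↦ c.fst ≫ proj π s i) ?_) ?_ ?_ ?_⟩⟩
  · intro i
    induction i using Fin.cases with
    | zero => exact c.condition.symm
    | succ i => simp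
  · intro c
    refine fiberPower_hom_ext (fun i ↦ ?_) ?_
    · rw [Category.assoc, fiberLift_proj, fiberLift_proj, Fin.cases_succ]
    · rw [Category.assoc, fiberLift_toBase, fiberLift_toBase]
  · intro c
    rw [fiberLift_proj, Fin.cases_zero]
  · intro c m h1 h2
    refine fiberPower_hom_ext (fun i ↦ ?_) ?_
    · induction i using Fin.cases with
      | zero => rw [fiberLift_proj, Fin.cases_zero, h2]
      | succ i => rw [fiberLift_proj, Fin.cases_succ, ← h1, Category.assoc, fiberLift_proj]
    · rw [fiberLift_toBase, ← h1, Category.assoc, fiberLift_toBase]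

theorem isIso_toBase_zero (π : X ⟶ Z) : IsIso (toBase π 0) :=
  ⟨fiberLift (𝟙 Z) (fun i ↦ i.elim0) (fun i ↦ i.elim0),
    fiberPower_hom_ext (fun i ↦ i.elim0) (by simp), by simp⟩

/-- A property of morphisms stable under composition and base change passes from the restriction
of `π` over an open subset to the restrictions of the structure maps of its fiber powers. -/
theorem toBase_morphismRestrict (P : MorphismProperty Scheme.{u}) [P.IsStableUnderBaseChange]
    [P.IsMultiplicative] (π : X ⟶ Z) (V : Z.Opens) (hP : P (π ∣_ V)) (s : ℕ) :
    P (toBase π s ∣_ V) := by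
  induction s with
  | zero =>
    have := isIso_toBase_zero π
    exact P.of_isIso _
  | succ s ih =>
    have h := P.comp_mem _ _
      (morphismRestrict_of_isPullback P (isPullback_fiberPower_succ π s) V hP) ih
    rw [← morphismRestrict_comp] at h
    exact (fiberLift_toBase (toBase π (s + 1)) (fun i ↦ proj π (s + 1) i.succ)
      (fun i ↦ proj_comp i.succ)) ▸ h

end FiberPower

/-! ### Geometric generic points of fiber powers -/

theorem exists_eq_SpecMap_fromSpecStalk {X : Scheme.{u}} {R : CommRingCat.{u}} [IsLocalRing R]
    (q : Spec R ⟶ X) {x : X} (hx : q (IsLocalRing.closedPoint R) = x) :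
    ∃ c : X.presheaf.stalk x ⟶ R, q = Spec.map c ≫ X.fromSpecStalk x := by
  subst hx
  exact ⟨Scheme.stalkClosedPointTo q, (Scheme.Spec_stalkClosedPointTo_fromSpecStalk q).symm⟩

/-- The unique point of the spectrum of a field. -/
def specPoint (Ω : Type u) [Field Ω] : Spec (.of Ω) :=
  IsLocalRing.closedPoint (CommRingCat.of Ω)

theorem eq_specPoint {Ω : Type u} [Field Ω] (x : Spec (.of Ω)) : x = specPoint Ω :=
  Subsingleton.elim (α := PrimeSpectrum Ω) _ _

section FunctionField

variable {X Z : Scheme.{u}} [IsIntegral X] [IsIntegral Z] (π : X ⟶ Z) [IsDominant π]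

/-- The function field of the source of `π`, regarded as an extension of that of the target. The
synonym depends on `π` so that the algebra structure can be an instance. -/
def CoverField (_π : X ⟶ Z) : Type u := X.functionField

noncomputable instance : Field (CoverField π) := inferInstanceAs (Field X.functionField)

noncomputable instance : Algebra Z.functionField (CoverField π) :=
  (functionFieldMap π).hom.toAlgebra

theorem genericPoint_eq : π (genericPoint X) = genericPoint Z :=
  ((map_genericPoint_specializes π).antisymm (genericPoint_specializes _)).eq

theorem fromSpecStalk_genericPoint_comp :
    X.fromSpecStalk (genericPoint X) ≫ π =
      Spec.map (functionFieldMap π) ≫ Z.fromSpecStalk (genericPoint Z) := by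
  rw [functionFieldMap, Spec.map_comp, Category.assoc,
    Scheme.SpecMap_stalkSpecializes_fromSpecStalk, Scheme.SpecMap_stalkMap_fromSpecStalk]

variable (Ω : Type u) [Field Ω] [Algebra Z.functionField Ω]

/-- The geometric generic point of `Z` defined by a field extension of its function field. -/
noncomputable def baseGeomPoint : Spec (.of Ω) ⟶ Z :=
  Spec.map (CommRingCat.ofHom (algebraMap Z.functionField Ω)) ≫ Z.fromSpecStalk (genericPoint Z)

variable {Ω} {π} {s : ℕ}

/-- The point of `X` with values in `Ω` defined by an embedding of the function field. -/
noncomputable def coverGeomPoint (f : CoverField π →ₐ[Z.functionField] Ω) : Spec (.of Ω) ⟶ X :=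
  Spec.map (CommRingCat.ofHom (R := X.functionField) f.toRingHom) ≫
    X.fromSpecStalk (genericPoint X)

theorem coverGeomPoint_comp (f : CoverField π →ₐ[Z.functionField] Ω) :
    coverGeomPoint f ≫ π = baseGeomPoint Ω := by
  rw [coverGeomPoint, Category.assoc, fromSpecStalk_genericPoint_comp, ← Category.assoc,
    ← Spec.map_comp, baseGeomPoint]
  congr 2
  ext x
  exact f.commutes x

theorem coverGeomPoint_injective :
    Function.Injective (coverGeomPoint (π := π) (Ω := Ω)) := by
  intro f g h
  rw [coverGeomPoint, coverGeomPoint, cancel_mono] at h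
  have := congrArg (fun a ↦ a.hom) (Spec.map_injective h)
  ext x
  exact DFunLike.congr_fun this x

/-- The geometric point of the fiber power given by a tuple of embeddings of the function field. -/
noncomputable def tupleGeomPoint (t : Fin s → CoverField π →ₐ[Z.functionField] Ω) :
    Spec (.of Ω) ⟶ fiberPower π s :=
  fiberLift (baseGeomPoint Ω) (fun i ↦ coverGeomPoint (t i)) (fun i ↦ coverGeomPoint_comp (t i))

/-- The point of the fiber power underlying `tupleGeomPoint`. -/
noncomputable def tuplePoint (t : Fin s → CoverField π →ₐ[Z.functionField] Ω) : fiberPower π s :=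
  tupleGeomPoint t (specPoint Ω)

theorem baseGeomPoint_apply (x : Spec (.of Ω)) :
    baseGeomPoint (Z := Z) Ω x = genericPoint Z := by
  have h : IsLocalHom (CommRingCat.ofHom (algebraMap Z.functionField Ω)).hom :=
    inferInstanceAs (IsLocalHom (algebraMap Z.functionField Ω))
  rw [eq_specPoint x, baseGeomPoint, Scheme.Hom.comp_apply]
  erw [Spec_closedPoint]
  exact Scheme.fromSpecStalk_closedPoint

theorem toBase_tuplePoint (t : Fin s → CoverField π →ₐ[Z.functionField] Ω) :
    toBase π s (tuplePoint t) = genericPoint Z := by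
  rw [tuplePoint, ← Scheme.Hom.comp_apply, tupleGeomPoint, fiberLift_toBase, baseGeomPoint_apply]

theorem permMap_tuplePoint (σ : Equiv.Perm (Fin s))
    (t : Fin s → CoverField π →ₐ[Z.functionField] Ω) :
    permMap π s σ (tuplePoint t) = tuplePoint (t ∘ ⇑σ⁻¹) := by
  have h : tupleGeomPoint t ≫ permMap π s σ = tupleGeomPoint (t ∘ ⇑σ⁻¹) := by
    refine fiberPower_hom_ext (fun i ↦ ?_) ?_
    · simp only [Category.assoc, permMap_proj, tupleGeomPoint, fiberLift_proj, Function.comp_apply]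
    · simp only [Category.assoc, permMap_toBase, tupleGeomPoint, fiberLift_toBase]
  rw [tuplePoint, tuplePoint, ← Scheme.Hom.comp_apply, h]

theorem tupleGeomPoint_injective :
    Function.Injective (tupleGeomPoint (π := π) (Ω := Ω) (s := s)) := by
  intro t t' h
  ext1 i
  have h' := congrArg (· ≫ proj π s i) h
  simp only [tupleGeomPoint, fiberLift_proj] at h'
  exact coverGeomPoint_injective h'

variable {Ω' : Type u} [Field Ω'] [Algebra Z.functionField Ω'] (j : Ω →ₐ[Z.functionField] Ω')

theorem SpecMap_baseGeomPoint :
    Spec.map (CommRingCat.ofHom j.toRingHom) ≫ baseGeomPoint (Z := Z) Ω =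
      baseGeomPoint Ω' := by
  rw [baseGeomPoint, ← Category.assoc, ← Spec.map_comp, baseGeomPoint, ← CommRingCat.ofHom_comp]
  congr 3
  exact j.comp_algebraMap

theorem SpecMap_coverGeomPoint (f : CoverField π →ₐ[Z.functionField] Ω) :
    Spec.map (CommRingCat.ofHom j.toRingHom) ≫ coverGeomPoint f = coverGeomPoint (j.comp f) := by
  rw [coverGeomPoint, ← Category.assoc, ← Spec.map_comp, coverGeomPoint]
  rfl

theorem SpecMap_tupleGeomPoint (t : Fin s → CoverField π →ₐ[Z.functionField] Ω) :
    Spec.map (CommRingCat.ofHom j.toRingHom) ≫ tupleGeomPoint t =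
      tupleGeomPoint (fun i ↦ j.comp (t i)) := by
  refine fiberPower_hom_ext (fun i ↦ ?_) ?_
  · simp only [Category.assoc, tupleGeomPoint, fiberLift_proj, SpecMap_coverGeomPoint]
  · simp only [Category.assoc, tupleGeomPoint, fiberLift_toBase, SpecMap_baseGeomPoint]

theorem tuplePoint_comp (t : Fin s → CoverField π →ₐ[Z.functionField] Ω) :
    tuplePoint (fun i ↦ j.comp (t i)) = tuplePoint t := by
  rw [tuplePoint, ← SpecMap_tupleGeomPoint, Scheme.Hom.comp_apply, tuplePoint]
  exact congrArg _ (eq_specPoint _)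

/-- A tuple whose point lies on the diagonal becomes a geometric point of the diagonal over a larger
field, and embeddings that agree after a field extension are equal. -/
theorem tuplePoint_mem_bigDiagonal_iff (t : Fin s → CoverField π →ₐ[Z.functionField] Ω) :
    tuplePoint t ∈ bigDiagonal π s ↔ ¬ Function.Injective t := by
  simp only [bigDiagonal, Set.mem_iUnion, Function.Injective, not_forall]
  constructor
  · rintro ⟨i, j, hij, y, hy⟩
    refine ⟨i, j, ?_, hij⟩
    obtain ⟨w, -, -⟩ := Scheme.Pullback.exists_preimage_pullback y
      (specPoint Ω) (f := equalizer.ι (proj π s i) (proj π s j))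
      (g := tupleGeomPoint t) hy
    -- The residue field of `w` is an extension of `Ω` over which the point lifts to the equalizer.
    let Y := pullback (equalizer.ι (proj π s i) (proj π s j)) (tupleGeomPoint t)
    obtain ⟨c, hc⟩ := Spec.map_surjective (Y.fromSpecResidueField w ≫ pullback.snd _ _)
    have h : Spec.map c ≫ coverGeomPoint (t i) = Spec.map c ≫ coverGeomPoint (t j) := by
      have h0 (k) : coverGeomPoint (t k) = tupleGeomPoint t ≫ proj π s k := by
        rw [tupleGeomPoint, fiberLift_proj]
      rw [h0, h0, hc]
      simp only [Category.assoc]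
      rw [← pullback.condition_assoc, ← pullback.condition_assoc, equalizer.condition]
    rw [coverGeomPoint, coverGeomPoint, ← Category.assoc, ← Category.assoc, cancel_mono,
      ← Spec.map_comp, ← Spec.map_comp] at h
    have h' := congrArg (fun a ↦ a.hom) (Spec.map_injective h)
    ext x
    exact c.hom.injective (DFunLike.congr_fun h' x)
  · rintro ⟨i, j, hij, hne⟩
    refine ⟨i, j, hne, equalizer.lift (tupleGeomPoint t) ?_ (specPoint Ω), ?_⟩
    · rw [tupleGeomPoint, fiberLift_proj, fiberLift_proj, hij]
    · rw [← Scheme.Hom.comp_apply, equalizer.lift_ι, tuplePoint]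

end FunctionField

/-! ### Galois conjugacy of geometric points -/

section FieldTheory

variable {F κ K Ω Ω' : Type*} [Field F] [Field κ] [Field K] [Field Ω] [Field Ω'] [Algebra F κ]
  [Algebra F K] [Algebra F Ω] [Algebra F Ω']

/-- Two embeddings into a normal extension differ by an automorphism of that extension. -/
theorem exists_algEquiv_comp_eq [Normal F Ω] (a b : κ →ₐ[F] Ω) :
    ∃ g : Ω ≃ₐ[F] Ω, ∀ x, g (a x) = b x := by
  let ea : κ ≃ₐ[F] a.fieldRange := AlgEquiv.ofInjectiveField a
  let eb : κ ≃ₐ[F] b.fieldRange := AlgEquiv.ofInjectiveField b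
  let e : a.fieldRange →ₐ[F] b.fieldRange := (ea.symm.trans eb).toAlgHom
  refine ⟨AlgEquiv.ofBijective (e.liftNormal Ω) (Algebra.IsAlgebraic.algHom_bijective _),
    fun x ↦ ?_⟩
  have h := e.liftNormal_commutes Ω (ea x)
  have h' : e (ea x) = eb x := congrArg eb (ea.symm_apply_apply x)
  rw [h'] at h
  exact h

theorem card_algHom_of_isAlgClosed [FiniteDimensional F K] [Algebra.IsSeparable F K]
    [IsAlgClosed Ω] : Nat.card (K →ₐ[F] Ω) = Module.finrank F K :=
  AlgHom.natCard_of_splits F K Ω fun _ ↦ IsAlgClosed.splits _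

/-- Both algebraically closed fields receive `[K : F]` embeddings of `K`, so composition with `j`
is a bijection between the two sets of embeddings. -/
theorem exists_comp_eq_of_isAlgClosed [FiniteDimensional F K] [Algebra.IsSeparable F K]
    [IsAlgClosed Ω] [IsAlgClosed Ω'] (j : Ω →ₐ[F] Ω') (f : K →ₐ[F] Ω') :
    ∃ f₀ : K →ₐ[F] Ω, j.comp f₀ = f := by
  have hinj : Function.Injective (fun f₀ : K →ₐ[F] Ω ↦ j.comp f₀) := fun f g h ↦ by
    ext x
    exact j.injective (DFunLike.congr_fun h x)
  exact ((Nat.bijective_iff_injective_and_card _).mpr ⟨hinj, by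
    rw [card_algHom_of_isAlgClosed, card_algHom_of_isAlgClosed]⟩).surjective f

end FieldTheory

section GenericFiber

variable {X Z : Scheme.{u}} [IsIntegral X] [IsIntegral Z] {π : X ⟶ Z} [IsDominant π] {s : ℕ}

/-- Any field-valued point of the fiber power over the generic point of `Z` comes from a tuple of
embeddings, for a suitable `k(Z)`-algebra structure on the field. -/
theorem exists_eq_tupleGeomPoint (hπ : ∀ x, π x = genericPoint Z → x = genericPoint X)
    {Ω : Type u} [Field Ω] (q : Spec (.of Ω) ⟶ fiberPower π s)
    (hq : toBase π s (q (specPoint Ω)) = genericPoint Z) :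
    ∃ (_ : Algebra Z.functionField Ω) (t : Fin s → CoverField π →ₐ[Z.functionField] Ω),
      q = tupleGeomPoint t := by
  obtain ⟨c, hc⟩ := exists_eq_SpecMap_fromSpecStalk (R := .of Ω) (q ≫ toBase π s)
    (x := genericPoint Z) ((Scheme.Hom.comp_apply _ _ _).trans hq)
  have hx (i : Fin s) : (q ≫ proj π s i) (specPoint Ω) = genericPoint X := by
    apply hπ
    rw [← Scheme.Hom.comp_apply, Category.assoc, proj_comp, Scheme.Hom.comp_apply, hq]
  choose f hf using fun i ↦ exists_eq_SpecMap_fromSpecStalk (R := .of Ω) (q ≫ proj π s i) (hx i)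
  have hcf (i : Fin s) : functionFieldMap π ≫ f i = c := by
    apply Spec.map_injective
    rw [← cancel_mono (Z.fromSpecStalk (genericPoint Z)), ← hc, Spec.map_comp, Category.assoc,
      ← fromSpecStalk_genericPoint_comp, ← Category.assoc, ← hf, Category.assoc, proj_comp]
  let _ : Algebra Z.functionField Ω := c.hom.toAlgebra
  refine ⟨inferInstance, fun i ↦ { (f i).hom with
    commutes' := fun x ↦ DFunLike.congr_fun (congrArg (fun a ↦ a.hom) (hcf i)) x }, ?_⟩
  refine fiberPower_hom_ext (fun i ↦ ?_) ?_
  · rw [hf, tupleGeomPoint, fiberLift_proj]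
    rfl
  · rw [hc, tupleGeomPoint, fiberLift_toBase]
    rfl

/-- Every point over the generic point of `Z` is hit by a tuple of embeddings into the algebraic
closure: an algebraic closure of the residue field of the point supplies embeddings into a larger
field, and these descend. -/
theorem exists_eq_tuplePoint [FiniteDimensional Z.functionField (CoverField π)]
    [Algebra.IsSeparable Z.functionField (CoverField π)]
    (hπ : ∀ x, π x = genericPoint Z → x = genericPoint X)
    {p : fiberPower π s} (hp : toBase π s p = genericPoint Z) :
    ∃ t : Fin s → CoverField π →ₐ[Z.functionField] AlgebraicClosure Z.functionField,
      tuplePoint t = p := by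
  let κ := (fiberPower π s).residueField p
  let Ω' := AlgebraicClosure κ
  let q : Spec (.of Ω') ⟶ fiberPower π s :=
    Spec.map (CommRingCat.ofHom (algebraMap κ Ω')) ≫ (fiberPower π s).fromSpecResidueField p
  have hqp : q (specPoint Ω') = p := by
    rw [Scheme.Hom.comp_apply, Scheme.fromSpecResidueField_apply]
  obtain ⟨_, t', ht'⟩ := exists_eq_tupleGeomPoint hπ q (by rw [hqp, hp])
  let j : AlgebraicClosure Z.functionField →ₐ[Z.functionField] Ω' := IsAlgClosed.lift
  choose t ht using fun i ↦ exists_comp_eq_of_isAlgClosed j (t' i)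
  refine ⟨t, ?_⟩
  rw [← tuplePoint_comp j, funext ht, tuplePoint, ← ht', hqp]

/-- A ring homomorphism relating two tuples of embeddings is automatically `k(Z)`-linear, since it
is compatible with the structure map to `Z`. -/
theorem exists_factor_residueField {Ω : Type u} [Field Ω] {κ : Type u} [Field κ]
    [Algebra Z.functionField Ω] [Algebra Z.functionField κ]
    {t : Fin s → CoverField π →ₐ[Z.functionField] Ω}
    {t₀ : Fin s → CoverField π →ₐ[Z.functionField] κ}
    (a : κ →+* Ω) (h : tupleGeomPoint t = Spec.map (CommRingCat.ofHom a) ≫ tupleGeomPoint t₀) :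
    ∃ b : κ →ₐ[Z.functionField] Ω, ∀ i, t i = b.comp (t₀ i) := by
  have hb := congrArg (· ≫ toBase π s) h
  simp only [Category.assoc, tupleGeomPoint, fiberLift_toBase] at hb
  rw [baseGeomPoint, baseGeomPoint, ← Category.assoc, cancel_mono, ← Spec.map_comp] at hb
  let b : κ →ₐ[Z.functionField] Ω := { a with
    commutes' := fun x ↦
      (DFunLike.congr_fun (congrArg (fun a ↦ a.hom) (Spec.map_injective hb)) x).symm }
  refine ⟨b, congrFun (tupleGeomPoint_injective (h.trans ?_))⟩
  exact SpecMap_tupleGeomPoint b t₀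

theorem exists_SpecMap_fromSpecResidueField {Y : Scheme.{u}} {Ω : Type u} [Field Ω]
    (q : Spec (.of Ω) ⟶ Y) {y : Y} (hq : q (specPoint Ω) = y) :
    ∃ a : Y.residueField y →+* Ω,
      q = Spec.map (CommRingCat.ofHom a) ≫ Y.fromSpecResidueField y := by
  subst hq
  exact ⟨_, (Scheme.descResidueField_stalkClosedPointTo_fromSpecResidueField Ω Y q).symm⟩

/-- Two tuples define the same point iff they are Galois conjugate: both factor through the residue
field of the common point. -/
theorem tuplePoint_eq_iff (hπ : ∀ x, π x = genericPoint Z → x = genericPoint X)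
    {t t' : Fin s → CoverField π →ₐ[Z.functionField] AlgebraicClosure Z.functionField} :
    tuplePoint t = tuplePoint t' ↔
      ∃ g : AlgebraicClosure Z.functionField ≃ₐ[Z.functionField] AlgebraicClosure Z.functionField,
        ∀ i, (g : _ →ₐ[Z.functionField] _).comp (t i) = t' i := by
  constructor
  · intro h
    let κ := (fiberPower π s).residueField (tuplePoint t)
    obtain ⟨_, t₀, ht₀⟩ := exists_eq_tupleGeomPoint hπ (Ω := κ)
      ((fiberPower π s).fromSpecResidueField (tuplePoint t))
      (by rw [Scheme.fromSpecResidueField_apply, toBase_tuplePoint])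
    obtain ⟨a, ha⟩ := exists_SpecMap_fromSpecResidueField (tupleGeomPoint t)
      (y := tuplePoint t) rfl
    obtain ⟨a', ha'⟩ := exists_SpecMap_fromSpecResidueField (tupleGeomPoint t') h.symm
    rw [ht₀] at ha ha'
    obtain ⟨b, hb⟩ := exists_factor_residueField a ha
    obtain ⟨b', hb'⟩ := exists_factor_residueField a' ha'
    obtain ⟨g, hg⟩ := exists_algEquiv_comp_eq b b'
    refine ⟨g, fun i ↦ ?_⟩
    ext x
    simp [hb, hb', hg]
  · rintro ⟨g, hg⟩
    rw [← tuplePoint_comp g.toAlgHom t]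
    exact congrArg _ (funext hg)

end GenericFiber

/-! ### Multiply transitive actions -/

section Action

/-- The automorphism group acts on the embeddings of an extension by composition. -/
instance galoisAction {F K Ω : Type*} [Field F] [Field K] [Field Ω] [Algebra F K] [Algebra F Ω] :
    MulAction (Ω ≃ₐ[F] Ω) (K →ₐ[F] Ω) where
  smul g f := (g : Ω →ₐ[F] Ω).comp f
  one_smul _ := rfl
  mul_smul _ _ _ := rfl

/-- If `M` is the group of permutations of `α` induced along `φ` by elements of `G`, then `M` and
`G` are `s`-transitive simultaneously. -/
theorem isMultiplyPretransitive_iff_of_equiv {G α E : Type*} [Group G] [MulAction G E]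
    (φ : α ≃ E) {M : Subgroup (Equiv.Perm α)}
    (hM : ∀ σ, σ ∈ M ↔ ∃ g : G, ∀ i, g • φ i = φ (σ⁻¹ i)) (s : ℕ) :
    MulAction.IsMultiplyPretransitive M α s ↔ MulAction.IsMultiplyPretransitive G E s := by
  rw [MulAction.isMultiplyPretransitive_iff, MulAction.isMultiplyPretransitive_iff]
  constructor
  · intro h x y
    obtain ⟨⟨σ, hσ⟩, hxy⟩ := h (y.trans φ.symm.toEmbedding) (x.trans φ.symm.toEmbedding)
    obtain ⟨g, hg⟩ := (hM σ).mp hσ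
    refine ⟨g, ?_⟩
    ext i
    have hi : σ (φ.symm (y i)) = φ.symm (x i) := DFunLike.congr_fun hxy i
    have := hg (φ.symm (x i))
    rwa [show σ⁻¹ (φ.symm (x i)) = φ.symm (y i) from Equiv.Perm.inv_eq_iff_eq.mpr hi.symm,
      φ.apply_symm_apply, φ.apply_symm_apply] at this
  · intro h x y
    obtain ⟨g, hg⟩ := h (y.trans φ.toEmbedding) (x.trans φ.toEmbedding)
    let σ : Equiv.Perm α := (φ.trans (MulAction.toPerm g)).trans φ.symm
    have hσ (i) : φ (σ i) = g • φ i := φ.apply_symm_apply _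
    refine ⟨⟨σ⁻¹, (hM _).mpr ⟨g, fun i ↦ by rw [inv_inv, hσ]⟩⟩, ?_⟩
    ext i
    have hi : g • φ (y i) = φ (x i) := DFunLike.congr_fun hg i
    change σ⁻¹ (x i) = y i
    rw [Equiv.Perm.inv_eq_iff_eq]
    exact φ.injective (by rw [hσ, hi])

end Action

/-! ### The locus of distinct coordinates -/

section DistinctLocus

variable {X Z : Scheme.{u}} {π : X ⟶ Z} {s : ℕ}

theorem isClosed_bigDiagonal [X.IsSeparated] (π : X ⟶ Z) (s : ℕ) :
    IsClosed (bigDiagonal π s) := by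
  refine isClosed_iUnion_of_finite fun i ↦ isClosed_iUnion_of_finite fun j ↦
    isClosed_iUnion_of_finite fun _ ↦ ?_
  exact (equalizer.ι (proj π s i) (proj π s j)).isClosedEmbedding.isClosed_range

/-- The points of the fiber power over the generic point of the base with distinct coordinates. -/
def genericDistinct [IrreducibleSpace Z] (π : X ⟶ Z) (s : ℕ) : Set (fiberPower π s) :=
  toBase π s ⁻¹' {genericPoint Z} \ bigDiagonal π s

theorem genericPoint_mem_of_mem [IrreducibleSpace Z] {V : Z.Opens} {z : Z} (hz : z ∈ V) :
    genericPoint Z ∈ V :=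
  (genericPoint_specializes z).mem_open V.2 hz

theorem exists_mem_etaleLocus {z : Z} (hz : z ∈ etaleLocus π) :
    ∃ V : Z.Opens, z ∈ V ∧ IsFinite (π ∣_ V) ∧ Etale (π ∣_ V) := by
  obtain ⟨V, hV, hzV⟩ := TopologicalSpace.Opens.mem_sSup.mp hz
  exact ⟨V, hzV, hV⟩

theorem isDiscrete_toBase_fiber {z : Z} (hz : z ∈ etaleLocus π) (s : ℕ) :
    _root_.IsDiscrete (toBase π s ⁻¹' {z}) := by
  obtain ⟨V, hzV, hfin, -⟩ := exists_mem_etaleLocus hz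
  have : LocallyQuasiFinite (toBase π s ∣_ V) :=
    toBase_morphismRestrict @LocallyQuasiFinite π V inferInstance s
  exact isDiscrete_fiber_of_mem _ V hzV

theorem eq_genericPoint_of_mem_etaleLocus [IsIntegral X] [IsIntegral Z] [IsDominant π]
    (hη : genericPoint Z ∈ etaleLocus π) (x : X) (hx : π x = genericPoint Z) :
    x = genericPoint X := by
  obtain ⟨V, hzV, hfin, -⟩ := exists_mem_etaleLocus hη
  exact ((isDiscrete_fiber_of_mem π V hzV).eq_of_specializes (genericPoint_specializes x)
    (genericPoint_eq π) hx).symm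

/-- Flatness lifts the generization from a point of the étale locus to the generic point of the
base, and the complement of the closed diagonal is stable under generization. -/
theorem distinctLocus_eq_closure [X.IsSeparated] [IsIntegral Z]
    (hη : genericPoint Z ∈ etaleLocus π) :
    distinctLocus π s = closure (genericDistinct π s) := by
  refine (closure_minimal ?_ isClosed_closure).antisymm (closure_mono ?_)
  · rintro w ⟨hw, hwΔ⟩
    obtain ⟨V, hwV, -, het⟩ := exists_mem_etaleLocus hw
    have : Flat (toBase π s ∣_ V) := toBase_morphismRestrict @Flat π V inferInstance s
    obtain ⟨y, hy, hyw⟩ := exists_specializes_of_flat (toBase π s) V hwV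
      (genericPoint_specializes _)
    have hyΔ : y ∉ bigDiagonal π s := fun h ↦ hwΔ (hyw.mem_closed (isClosed_bigDiagonal π s) h)
    have hyP : y ∈ genericDistinct π s := ⟨hy, hyΔ⟩
    exact closure_mono (Set.singleton_subset_iff.mpr hyP) hyw.mem_closure
  · rintro p ⟨hp, hpΔ⟩
    exact ⟨show toBase π s p ∈ etaleLocus π from (show toBase π s p = _ from hp) ▸ hη, hpΔ⟩

/-- A permutation preserves the closure of a point exactly when it fixes that point, as schemes
are `T0` spaces. -/
theorem mem_monodromyGroup_closure_singleton_iff (p : fiberPower π s) (σ : Equiv.Perm (Fin s)) :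
    σ ∈ monodromyGroup π s (closure {p}) ↔ permMap π s σ p = p := by
  have : IsIso (permMap π s σ) := ⟨permMap π s σ⁻¹, by
    rw [← permMap_mul, inv_mul_cancel, permMap_one], by
    rw [← permMap_mul, mul_inv_cancel, permMap_one]⟩
  change permMap π s σ '' closure {p} = closure {p} ↔ _
  rw [show permMap π s σ '' closure {p} = closure {permMap π s σ p}
      from ((permMap π s σ).homeomorph.image_closure {p}).trans
        (by rw [Set.image_singleton]; rfl),
    ← inseparable_iff_closure_eq, inseparable_iff_eq]

end DistinctLocus

/-! ### Irreducibility as transitivity of the Galois group -/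

section GaloisOrbits

variable {X Z : Scheme.{u}} [IsIntegral X] [IsIntegral Z] {π : X ⟶ Z} [IsDominant π]
  [FiniteDimensional Z.functionField (CoverField π)]
  [Algebra.IsSeparable Z.functionField (CoverField π)] {s : ℕ}

theorem genericDistinct_eq_range (hη : genericPoint Z ∈ etaleLocus π) :
    genericDistinct π s = Set.range fun
      t : Fin s ↪ (CoverField π →ₐ[Z.functionField] AlgebraicClosure Z.functionField) ↦
        tuplePoint t := by
  ext p
  constructor
  · rintro ⟨hp, hpΔ⟩
    obtain ⟨t, rfl⟩ := exists_eq_tuplePoint (eq_genericPoint_of_mem_etaleLocus hη) hp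
    rw [tuplePoint_mem_bigDiagonal_iff, not_not] at hpΔ
    exact ⟨⟨t, hpΔ⟩, rfl⟩
  · rintro ⟨t, rfl⟩
    refine ⟨toBase_tuplePoint _, ?_⟩
    rw [tuplePoint_mem_bigDiagonal_iff, not_not]
    exact t.injective

theorem isIrreducible_distinctLocus_iff [X.IsSeparated] (hη : genericPoint Z ∈ etaleLocus π)
    (hs : s ≤ degree π) :
    IsIrreducible (distinctLocus π s) ↔ MulAction.IsMultiplyPretransitive
      (AlgebraicClosure Z.functionField ≃ₐ[Z.functionField] AlgebraicClosure Z.functionField)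
      (CoverField π →ₐ[Z.functionField] AlgebraicClosure Z.functionField) s := by
  have hne : (genericDistinct π s).Nonempty := by
    rw [genericDistinct_eq_range hη, Set.range_nonempty_iff_nonempty,
      Function.Embedding.nonempty_iff_card_le, Fintype.card_fin, AlgHom.card]
    exact hs
  have hdis : _root_.IsDiscrete (genericDistinct π s) :=
    (isDiscrete_toBase_fiber hη s).mono Set.sdiff_subset
  rw [distinctLocus_eq_closure hη, isIrreducible_closure_iff_of_isDiscrete hdis hne,
    genericDistinct_eq_range hη, MulAction.isMultiplyPretransitive_iff]
  simp only [Set.Subsingleton, Set.forall_mem_range,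
    tuplePoint_eq_iff (eq_genericPoint_of_mem_etaleLocus hη)]
  refine forall₂_congr fun t t' ↦ exists_congr fun g ↦ ?_
  rw [DFunLike.ext_iff]
  rfl

end GaloisOrbits

end BranchedCover

theorem proposition1p2 {k : Type u} [Field k] {X Z : Scheme.{u}}
    [X.Over (Spec (.of k))] [Z.Over (Spec (.of k))]
    [IsIntegral X] [IsSeparated (X ↘ Spec (.of k))]
    [LocallyOfFiniteType (X ↘ Spec (.of k))] [QuasiCompact (X ↘ Spec (.of k))]
    [IsIntegral Z] [IsSeparated (Z ↘ Spec (.of k))]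
    [LocallyOfFiniteType (Z ↘ Spec (.of k))] [QuasiCompact (Z ↘ Spec (.of k))]
    (π : X ⟶ Z) [π.IsOver (Spec (.of k))] [BranchedCover.IsBranchedCover π]
    (X' : Set (BranchedCover.fiberPower π (BranchedCover.degree π)))
    (hX' : BranchedCover.IsComponentOf X'
      (BranchedCover.distinctLocus π (BranchedCover.degree π)))
    (s : ℕ) (hs : 1 ≤ s) (hsd : s ≤ BranchedCover.degree π) :
    MulAction.IsMultiplyPretransitive
        (BranchedCover.monodromyGroup π (BranchedCover.degree π) X')
        (Fin (BranchedCover.degree π)) s ↔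
      IsIrreducible (BranchedCover.distinctLocus π s) := by
  have hsep : X.IsSeparated := ⟨by
    rw [← terminal.comp_from (X ↘ Spec (.of k))]
    infer_instance⟩
  have : Algebra.IsSeparable Z.functionField (BranchedCover.CoverField π) :=
    BranchedCover.IsBranchedCover.separable
  -- A positive `Module.finrank` excludes the junk value of an infinite extension.
  have : FiniteDimensional Z.functionField (BranchedCover.CoverField π) :=
    Module.finite_of_finrank_pos (hs.trans hsd)
  -- The étale locus is nonempty because `X'` is a nonempty subset of the closure of its preimage.
  have hη : genericPoint Z ∈ BranchedCover.etaleLocus π := by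
    obtain ⟨x, hx⟩ := closure_nonempty_iff.mp (hX'.1.1.1.mono hX'.1.2)
    exact BranchedCover.genericPoint_mem_of_mem hx.1
  rw [BranchedCover.isIrreducible_distinctLocus_iff hη hsd]
  rw [BranchedCover.distinctLocus_eq_closure hη] at hX'
  obtain ⟨p, hp, rfl⟩ := hX'.exists_eq_closure_singleton (by
    rw [BranchedCover.genericDistinct_eq_range hη]
    exact Set.finite_range _)
  rw [BranchedCover.genericDistinct_eq_range hη] at hp
  obtain ⟨t, rfl⟩ := hp
  -- There are exactly `[k(X) : k(Z)]` embeddings, so an injective tuple of that length lists all.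
  have hbij : Function.Bijective t := by
    rw [Fintype.bijective_iff_injective_and_card, Fintype.card_fin, AlgHom.card]
    exact ⟨t.injective, rfl⟩
  refine BranchedCover.isMultiplyPretransitive_iff_of_equiv (Equiv.ofBijective t hbij)
    (fun σ ↦ ?_) s
  rw [BranchedCover.mem_monodromyGroup_closure_singleton_iff, BranchedCover.permMap_tuplePoint,
    eq_comm, BranchedCover.tuplePoint_eq_iff (BranchedCover.eq_genericPoint_of_mem_etaleLocus hη)]
  rfl
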